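/- Let $\mathfrak g$ be a finite-dimensional simple Lie algebra over $\mathbb C$, and fix a nondegenerate symmetric invariant bilinear form $\kappa$ on $\mathfrak g$; an element $a\in\mathfrak g$ is regarded as the linear function $\kappa(a,\cdot)$ on $\mathfrak g$, so that $S\mathfrak g$ is the algebra of polynomial functions on $\mathfrak g$, with the action of $\mathfrak g$ by derivations extending the adjoint action. Let $b_i$ be a basis of $\mathfrak g$ and $b^i$ the $\kappa$-dual basis. Let $\Pi\mathfrak g$ be the odd vector space with underlying space $\mathfrak g$, whose algebra of functions is $\wedge\mathfrak g$, and let $B$ be the algebra of functions on the superscheme $\{X\in\Pi\mathfrak g:\{X,X\}=0\}$. That is, $B$ is the quotient of $\wedge\mathfrak g$ by the ideal generated by the elements $\sum_{i,j}\kappa(a,[b_i,b_j])\,b^i\wedge b^j$, $a\in\mathfrak g$. Let $B\otimes B$ be the tensor product of superalgebras, i.e. the algebra of functions of pairs $(X,Y)$ with $\{X,X\}=\{Y,Y\}=0$, with the diagonal action of $\mathfrak g$ by derivations, and let $E=(B\otimes B)^{\mathfrak g}$. Write $x_i=b^i\otimes 1$ and $y_i=1\otimes b^i$ for the coordinates of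 $X=\sum_i b_i x_i$ and $Y=\sum_i b_i y_i$, and $\{X,Y\}=\sum_{i,j}[b_i,b_j]\,x_iy_j$. For $F\in S\mathfrak g$ let $F(\{X,Y\})\in B\otimes B$ be the image of $F$ under the algebra homomorphism that sends $a\in\mathfrak g$ to $\kappa(a,\{X,Y\})=\sum_{i,j}\kappa(a,[b_i,b_j])\,x_iy_j$. With $\partial_i$ the derivative in the direction $b_i$, put $$dF(\{X,Y\})(X)=\sum_i(\partial_iF)(\{X,Y\})\,x_i,\qquad dF(\{X,Y\})(Y)=\sum_i(\partial_iF)(\{X,Y\})\,y_i,$$ $$\widehat F(X,Y)=d^2F(\{X,Y\})(X\otimes Y)=\sum_{i,j}(\partial_i\partial_jF)(\{X,Y\})\,x_iy_j .$$ Then: 1. for every $F\in(S\mathfrak g)^{\mathfrak g}$, the element $\widehat F$ lies in $E$; 2. for every homogeneous $F\in(S\mathfrak g)^{\mathfrak g}$ of positive degree, $F(\{X,Y\})=0$ and $dF(\{X,Y\})(X)=dF(\{X,Y\})(Y)=0$ in $B\otimes B$; 3. for any two homogeneous $F,H\in(S\mathfrak g)^{\mathfrak g}$ of positive degrees, $\widehat{FH}=0$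 in $E$. -/

import Mathlib

open scoped TensorProduct DirectSum

noncomputable section

namespace SuperLie

/-! ### Derivations from square-zero extensions -/

section Derivations

variable {K : Type*} [Field K]

/-- The derivation of the symmetric algebra `S(M)` whose value on a generator `m ∈ M` is `φ m`. -/
def symDer {M : Type*} [AddCommGroup M] [Module K M]
    (φ : M →ₗ[K] SymmetricAlgebra K M) :
    SymmetricAlgebra K M →ₗ[K] SymmetricAlgebra K M :=
  (TrivSqZeroExt.sndHom _ _).restrictScalars K ∘ₗ
    (SymmetricAlgebra.lift (A := TrivSqZeroExt (SymmetricAlgebra K M) (SymmetricAlgebra K M))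
      (((TrivSqZeroExt.inlAlgHom K (SymmetricAlgebra K M)
          (SymmetricAlgebra K M)).toLinearMap ∘ₗ SymmetricAlgebra.ι K M) +
        ((TrivSqZeroExt.inrHom (SymmetricAlgebra K M)
          (SymmetricAlgebra K M)).restrictScalars K ∘ₗ φ))).toLinearMap

theorem symDer_ι {M : Type*} [AddCommGroup M] [Module K M]
    (φ : M →ₗ[K] SymmetricAlgebra K M) (m : M) :
    symDer φ (SymmetricAlgebra.ι K M m) = φ m := by
  simp [symDer]

theorem symDer_mul {M : Type*} [AddCommGroup M] [Module K M]
    (φ : M →ₗ[K] SymmetricAlgebra K M) (a b : SymmetricAlgebra K M) :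
    symDer φ (a * b) = a * symDer φ b + b * symDer φ a := by
  have key : ∀ c, (SymmetricAlgebra.lift
      (A := TrivSqZeroExt (SymmetricAlgebra K M) (SymmetricAlgebra K M))
      (((TrivSqZeroExt.inlAlgHom K (SymmetricAlgebra K M)
          (SymmetricAlgebra K M)).toLinearMap ∘ₗ SymmetricAlgebra.ι K M) +
        ((TrivSqZeroExt.inrHom (SymmetricAlgebra K M)
          (SymmetricAlgebra K M)).restrictScalars K ∘ₗ φ)) c).fst = c := by
    intro c
    induction c using SymmetricAlgebra.induction with
    | algebraMap r => rw [AlgHom.commutes]; rfl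
    | ι x => simp
    | mul a b ha hb => simp [ha, hb]
    | add a b ha hb => simp [ha, hb]
  simp [symDer, key, mul_comm]

/-- The extension of a linear map `f : M → A` with pairwise commuting values to a homomorphism
of algebras `S(M) → A`, where `A` need not be commutative. -/
def symLift {M : Type*} [AddCommGroup M] [Module K M] {A : Type*} [Ring A] [Algebra K A]
    (f : M →ₗ[K] A) (hf : ∀ x y, f x * f y = f y * f x) : SymmetricAlgebra K M →ₐ[K] A :=
  RingCon.liftₐ (TensorAlgebra.symRingCon K M) (TensorAlgebra.lift K f) (by
    refine RingCon.ringConGen_le.2 (fun x y h => ?_)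
    induction h with
    | mul_comm x y => simpa [RingCon.ker_apply] using hf x y)

theorem symLift_ι {M : Type*} [AddCommGroup M] [Module K M] {A : Type*} [Ring A] [Algebra K A]
    (f : M →ₗ[K] A) (hf : ∀ x y, f x * f y = f y * f x) (m : M) :
    symLift f hf (SymmetricAlgebra.ι K M m) = f m := by
  have h := RingCon.liftₐ_mk (R := K) (TensorAlgebra.symRingCon K M) (TensorAlgebra.lift K f) (by
    refine RingCon.ringConGen_le.2 (fun x y h => ?_)
    induction h with
    | mul_comm x y => simpa [RingCon.ker_apply] using hf x y) (TensorAlgebra.ι K m)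
  rw [TensorAlgebra.lift_ι_apply] at h
  exact h

end Derivations

/-! ### Invariant forms and the supercommutator -/

/-- A nondegenerate symmetric invariant bilinear form on a Lie algebra. -/
structure InvForm (K : Type*) [Field K] (𝔤 : Type*) [LieRing 𝔤] [LieAlgebra K 𝔤] where
  form : LinearMap.BilinForm K 𝔤
  nondegenerate : form.Nondegenerate
  isSymm : form.IsSymm
  lieInvariant : form.lieInvariant 𝔤

variable {K : Type*} [Field K] {𝔤 : Type*} [LieRing 𝔤] [LieAlgebra K 𝔤] [FiniteDimensional K 𝔤]

/-- A basis `b i` of `𝔤`. Everything below is independent of the choice of it. -/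
abbrev bas (K : Type*) [Field K] (𝔤 : Type*) [LieRing 𝔤] [LieAlgebra K 𝔤]
    [FiniteDimensional K 𝔤] : Module.Basis (Fin (Module.finrank K 𝔤)) K 𝔤 :=
  Module.finBasis K 𝔤

/-- The basis `b' i` dual to `b i` with respect to the form `κ`. -/
def dualBas (κ : InvForm K 𝔤) : Module.Basis (Fin (Module.finrank K 𝔤)) K 𝔤 :=
  κ.form.dualBasis κ.nondegenerate (bas K 𝔤)

/-- Let `T` be an algebra. A linear map `f : 𝔤 → T` with odd values is the same as the `T`-valued
point `X = ∑ i, b i ⊗ f (b' i)` of `Π𝔤`; it is characterized by `κ(a, X) = f a`.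
For two such points `X = ∑ b i ⊗ x i` and `Y = ∑ b j ⊗ y j` one has
`{X, Y} = XY + YX = ∑ (b i * b j - b j * b i) ⊗ x i * y j = ∑ i, ∑ j, ⁅b i, b j⁆ ⊗ x i * y j`,
and `superBracket κ f g a` is `κ(a, {X, Y})`, the value at `{X, Y}` of the linear function
on `𝔤` corresponding to `a`. -/
def superBracket (κ : InvForm K 𝔤) {T : Type*} [Ring T] [Algebra K T] (f g : 𝔤 →ₗ[K] T) :
    𝔤 →ₗ[K] T :=
  ∑ i, ∑ j, (κ.form.flip ⁅bas K 𝔤 i, bas K 𝔤 j⁆).smulRight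
    (f (dualBas κ i) * g (dualBas κ j))

theorem superBracket_apply (κ : InvForm K 𝔤) {T : Type*} [Ring T] [Algebra K T]
    (f g : 𝔤 →ₗ[K] T) (a : 𝔤) :
    superBracket κ f g a = ∑ i, ∑ j, κ.form a ⁅bas K 𝔤 i, bas K 𝔤 j⁆ •
      (f (dualBas κ i) * g (dualBas κ j)) := by
  simp [superBracket, LinearMap.sum_apply]

theorem map_superBracket (κ : InvForm K 𝔤) {T T' : Type*} [Ring T] [Algebra K T] [Ring T']
    [Algebra K T'] (φ : T →ₐ[K] T') (f g : 𝔤 →ₗ[K] T) (a : 𝔤) :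
    φ (superBracket κ f g a) = superBracket κ (φ.toLinearMap ∘ₗ f) (φ.toLinearMap ∘ₗ g) a := by
  simp [superBracket_apply]

theorem sum_dualBas (κ : InvForm K 𝔤) (v : 𝔤) :
    v = ∑ i, κ.form v (bas K 𝔤 i) • dualBas κ i := by
  conv_lhs => rw [← (dualBas κ).sum_repr v]
  refine Finset.sum_congr rfl fun i _ => ?_
  rw [dualBas, LinearMap.BilinForm.dualBasis_repr_apply]

theorem sum_bas (κ : InvForm K 𝔤) (v : 𝔤) :
    v = ∑ i, κ.form (dualBas κ i) v • bas K 𝔤 i := by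
  conv_lhs => rw [← (bas K 𝔤).sum_repr v]
  refine Finset.sum_congr rfl fun i _ => ?_
  congr 1
  have h := congrArg (κ.form (dualBas κ i)) ((bas K 𝔤).sum_repr v)
  rw [map_sum] at h
  simp_rw [map_smul, dualBas, LinearMap.BilinForm.apply_dualBasis_left] at h
  rw [dualBas, ← h]
  simp

/-- Invariance of the canonical element `∑ i, b i ⊗ b' i`. -/
theorem casimir_invariant (κ : InvForm K 𝔤) {V : Type*} [AddCommGroup V] [Module K V]
    (β : 𝔤 →ₗ[K] 𝔤 →ₗ[K] V) (x : 𝔤) :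
    ∑ i, β (bas K 𝔤 i) ⁅x, dualBas κ i⁆ = - ∑ i, β ⁅x, bas K 𝔤 i⁆ (dualBas κ i) := by
  have h1 : ∀ i, β (bas K 𝔤 i) ⁅x, dualBas κ i⁆
      = ∑ j, κ.form ⁅x, dualBas κ i⁆ (bas K 𝔤 j) • β (bas K 𝔤 i) (dualBas κ j) := by
    intro i
    conv_lhs => rw [sum_dualBas κ ⁅x, dualBas κ i⁆]
    simp
  have h2 : ∀ i, β ⁅x, bas K 𝔤 i⁆ (dualBas κ i)
      = ∑ j, κ.form (dualBas κ j) ⁅x, bas K 𝔤 i⁆ • β (bas K 𝔤 j) (dualBas κ i) := by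
    intro i
    conv_lhs => rw [sum_bas κ ⁅x, bas K 𝔤 i⁆]
    simp
  simp_rw [h1, h2]
  rw [Finset.sum_comm, ← Finset.sum_neg_distrib]
  refine Finset.sum_congr rfl fun i _ => ?_
  rw [← Finset.sum_neg_distrib]
  refine Finset.sum_congr rfl fun j _ => ?_
  rw [κ.lieInvariant, neg_smul]

/-- The supercommutator is equivariant. -/
theorem superBracket_lie (κ : InvForm K 𝔤) {T : Type*} [Ring T] [Algebra K T]
    (f g : 𝔤 →ₗ[K] T) (x a : 𝔤) :
    superBracket κ (f ∘ₗ (LieAlgebra.ad K 𝔤 x : 𝔤 →ₗ[K] 𝔤)) g a +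
      superBracket κ f (g ∘ₗ (LieAlgebra.ad K 𝔤 x : 𝔤 →ₗ[K] 𝔤)) a
      = superBracket κ f g ⁅x, a⁆ := by
  have e1 : superBracket κ (f ∘ₗ (LieAlgebra.ad K 𝔤 x : 𝔤 →ₗ[K] 𝔤)) g a
      = - ∑ i, ∑ j, κ.form a ⁅⁅x, bas K 𝔤 i⁆, bas K 𝔤 j⁆ •
        (f (dualBas κ i) * g (dualBas κ j)) := by
    rw [superBracket_apply, Finset.sum_comm]
    conv_rhs => rw [Finset.sum_comm]
    rw [← Finset.sum_neg_distrib]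
    refine Finset.sum_congr rfl fun j _ => ?_
    exact casimir_invariant κ (LinearMap.mk₂ K
      (fun u v => κ.form a ⁅u, bas K 𝔤 j⁆ • (f v * g (dualBas κ j)))
      (by intros; simp [add_smul]) (by intros; simp [mul_smul])
      (by intros; simp [add_mul])
      (by intros; rw [map_smul, smul_mul_assoc, smul_comm])) x
  have e2 : superBracket κ f (g ∘ₗ (LieAlgebra.ad K 𝔤 x : 𝔤 →ₗ[K] 𝔤)) a
      = - ∑ i, ∑ j, κ.form a ⁅bas K 𝔤 i, ⁅x, bas K 𝔤 j⁆⁆ •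
        (f (dualBas κ i) * g (dualBas κ j)) := by
    rw [superBracket_apply, ← Finset.sum_neg_distrib]
    refine Finset.sum_congr rfl fun i _ => ?_
    exact casimir_invariant κ (LinearMap.mk₂ K
      (fun u v => κ.form a ⁅bas K 𝔤 i, u⁆ • (f (dualBas κ i) * g v))
      (by intros; simp [add_smul]) (by intros; simp [mul_smul])
      (by intros; simp [mul_add])
      (by intros; rw [map_smul, mul_smul_comm, smul_comm])) x
  rw [e1, e2, superBracket_apply, ← neg_add, ← Finset.sum_add_distrib, ← Finset.sum_neg_distrib]
  refine Finset.sum_congr rfl fun i _ => ?_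
  rw [← Finset.sum_add_distrib, ← Finset.sum_neg_distrib]
  refine Finset.sum_congr rfl fun j _ => ?_
  rw [← add_smul, ← neg_smul, κ.lieInvariant, ← map_add, leibniz_lie x]

theorem superBracket_fst (κ : InvForm K 𝔤) {T : Type*} [Ring T] [Algebra K T]
    (f : 𝔤 →ₗ[K] TrivSqZeroExt T T) (f₀ : 𝔤 →ₗ[K] T) (h : ∀ c, (f c).fst = f₀ c) (a : 𝔤) :
    (superBracket κ f f a).fst = superBracket κ f₀ f₀ a := by
  simp only [superBracket_apply, TrivSqZeroExt.fst_sum, TrivSqZeroExt.fst_smul,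
    TrivSqZeroExt.fst_mul, h]

theorem superBracket_snd (κ : InvForm K 𝔤) {T : Type*} [Ring T] [Algebra K T]
    (f : 𝔤 →ₗ[K] TrivSqZeroExt T T) (f₀ f₁ : 𝔤 →ₗ[K] T) (h : ∀ c, (f c).fst = f₀ c)
    (h' : ∀ c, (f c).snd = f₁ c) (a : 𝔤) :
    (superBracket κ f f a).snd = superBracket κ f₁ f₀ a + superBracket κ f₀ f₁ a := by
  simp only [superBracket_apply, ← Finset.sum_add_distrib, TrivSqZeroExt.snd_sum,
    TrivSqZeroExt.snd_smul, TrivSqZeroExt.snd_mul, h, h', ← smul_add]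
  refine Finset.sum_congr rfl fun i _ => Finset.sum_congr rfl fun j _ => ?_
  rw [smul_eq_mul, op_smul_eq_mul, add_comm]

/-! ### The algebra `B` -/

/-- The relations `{X, X} = 0` in the algebra `⋀ 𝔤` of functions on `Π𝔤`. -/
inductive nilRel (κ : InvForm K 𝔤) : ExteriorAlgebra K 𝔤 → ExteriorAlgebra K 𝔤 → Prop where
  | mk (a : 𝔤) : nilRel κ (superBracket κ (ExteriorAlgebra.ι K) (ExteriorAlgebra.ι K) a) 0

/-- The algebra `B` of functions on the superscheme of all `X ∈ Π𝔤` with `{X, X} = 0`. -/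
abbrev AlgB (κ : InvForm K 𝔤) : Type _ := RingQuot (nilRel κ)

/-- The generators of `B`: the linear function on `Π𝔤` corresponding to an element of `𝔤`. -/
def genB (κ : InvForm K 𝔤) : 𝔤 →ₗ[K] AlgB κ :=
  (RingQuot.mkAlgHom K (nilRel κ)).toLinearMap ∘ₗ ExteriorAlgebra.ι K

theorem genB_sq (κ : InvForm K 𝔤) (a : 𝔤) : genB κ a * genB κ a = 0 := by
  simp [genB, ← map_mul]

theorem genB_anti (κ : InvForm K 𝔤) (a c : 𝔤) : genB κ a * genB κ c + genB κ c * genB κ a = 0 := by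
  have h := genB_sq κ (a + c)
  simpa [add_mul, mul_add, genB_sq, add_comm] using h

theorem superBracket_genB (κ : InvForm K 𝔤) (a : 𝔤) :
    superBracket κ (genB κ) (genB κ) a = 0 := by
  have h := RingQuot.mkAlgHom_rel K (nilRel.mk (κ := κ) a)
  rwa [map_superBracket, map_zero] at h

/-- The universal property of `B`. -/
def liftB (κ : InvForm K 𝔤) {T : Type*} [Ring T] [Algebra K T] (f : 𝔤 →ₗ[K] T)
    (hf : ∀ a, f a * f a = 0) (hs : ∀ a, superBracket κ f f a = 0) : AlgB κ →ₐ[K] T :=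
  RingQuot.liftAlgHom K ⟨ExteriorAlgebra.lift K ⟨f, hf⟩, by
    rintro _ _ ⟨a⟩
    rw [map_superBracket, map_zero, ExteriorAlgebra.ι_comp_lift, hs]⟩

theorem liftB_genB (κ : InvForm K 𝔤) {T : Type*} [Ring T] [Algebra K T] (f : 𝔤 →ₗ[K] T)
    (hf : ∀ a, f a * f a = 0) (hs : ∀ a, superBracket κ f f a = 0) (a : 𝔤) :
    liftB κ f hf hs (genB κ a) = f a := by
  simp [liftB, genB]

theorem algHomB_ext (κ : InvForm K 𝔤) {T : Type*} [Ring T] [Algebra K T]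
    {φ ψ : AlgB κ →ₐ[K] T} (h : ∀ a, φ (genB κ a) = ψ (genB κ a)) : φ = ψ := by
  apply RingQuot.ringQuot_ext'
  apply ExteriorAlgebra.hom_ext
  ext a
  exact h a

/-- The homogeneous component of degree `n` of `B`. -/
abbrev gradB (κ : InvForm K 𝔤) (n : ℕ) : Submodule K (AlgB κ) := LinearMap.range (genB κ) ^ n

instance gradB_monoid (κ : InvForm K 𝔤) : SetLike.GradedMonoid (gradB κ) :=
  Submodule.nat_power_gradedMonoid (LinearMap.range (genB κ))

theorem genB_mem (κ : InvForm K 𝔤) (a : 𝔤) : genB κ a ∈ gradB κ 1 := by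
  simp [gradB]

/-- The generators of `B`, as elements of degree one of the direct sum of its components. -/
def gradedGenB (κ : InvForm K 𝔤) : 𝔤 →ₗ[K] ⨁ n : ℕ, gradB κ n :=
  DirectSum.lof K ℕ (fun n => gradB κ n) 1 ∘ₗ (genB κ).codRestrict _ (genB_mem κ)

theorem gradedGenB_mul (κ : InvForm K 𝔤) (a c : 𝔤) :
    gradedGenB κ a * gradedGenB κ c = DirectSum.lof K ℕ (fun n => gradB κ n) (1 + 1)
      ⟨genB κ a * genB κ c, SetLike.mul_mem_graded (genB_mem κ a) (genB_mem κ c)⟩ := by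
  simp only [gradedGenB, LinearMap.comp_apply, DirectSum.lof_eq_of, DirectSum.of_mul_of]
  rfl

/-- The splitting of `B` into homogeneous components. -/
def decomposeB (κ : InvForm K 𝔤) : AlgB κ →ₐ[K] ⨁ n : ℕ, gradB κ n :=
  liftB κ (T := ⨁ n : ℕ, gradB κ n) (gradedGenB κ)
    (fun a => by
      rw [gradedGenB_mul]
      refine Eq.trans (congrArg _ ?_) (map_zero (DirectSum.lof K ℕ (fun n => gradB κ n) (1 + 1)))
      exact Subtype.ext (genB_sq κ a))
    (fun a => by
      rw [superBracket_apply]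
      simp_rw [gradedGenB_mul, ← map_smul, ← map_sum]
      refine Eq.trans (congrArg _ ?_) (map_zero (DirectSum.lof K ℕ (fun n => gradB κ n) (1 + 1)))
      refine Subtype.ext ?_
      refine Eq.trans ?_ (superBracket_genB κ a)
      rw [superBracket_apply]
      simp)

theorem decomposeB_coe (κ : InvForm K 𝔤) (n : ℕ) (t : gradB κ n) :
    decomposeB κ t = DirectSum.of (fun n => gradB κ n) n t := by
  obtain ⟨t, ht⟩ := t
  dsimp only [Subtype.coe_mk]
  induction ht using Submodule.pow_induction_on_left' with
  | algebraMap => simp_rw [AlgHom.commutes, DirectSum.algebraMap_apply]; rfl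
  | add _ _ _ _ _ ihx ihy => simp_rw [map_add, ihx, ihy, ← map_add]; rfl
  | mem_mul _ hm _ _ _ ih =>
      obtain ⟨_, rfl⟩ := hm
      simp_rw [map_mul, ih, decomposeB, liftB_genB, gradedGenB, LinearMap.comp_apply,
        DirectSum.lof_eq_of, DirectSum.of_mul_of]
      exact DirectSum.of_eq_of_gradedMonoid_eq (Sigma.subtype_ext (add_comm _ _) rfl)

/-- The grading of `B` in which the generators have degree one. -/
instance gradedAlgebraB (κ : InvForm K 𝔤) : GradedAlgebra (gradB κ) :=
  GradedAlgebra.ofAlgHom _ (decomposeB κ)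
    (by
      apply algHomB_ext
      intro a
      simp only [AlgHom.comp_apply, AlgHom.id_apply, decomposeB, liftB_genB, gradedGenB,
        LinearMap.comp_apply, DirectSum.lof_eq_of, DirectSum.coeAlgHom_of]
      rfl)
    (decomposeB_coe κ)

/-- The homomorphism `t ↦ t + ε (x • t)` from `B` to `B[ε]`, where `x ∈ 𝔤` acts on `B` by the
derivation extending the adjoint action on the generators. -/
def actHomB (κ : InvForm K 𝔤) (x : 𝔤) : AlgB κ →ₐ[K] TrivSqZeroExt (AlgB κ) (AlgB κ) :=
  liftB κ ((TrivSqZeroExt.inlAlgHom K (AlgB κ) (AlgB κ)).toLinearMap ∘ₗ genB κ +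
      ((TrivSqZeroExt.inrHom (AlgB κ) (AlgB κ)).restrictScalars K ∘ₗ genB κ ∘ₗ
        (LieAlgebra.ad K 𝔤 x : 𝔤 →ₗ[K] 𝔤)))
    (fun a => by
      ext
      · simp [genB_sq]
      · simpa using genB_anti κ a ⁅x, a⁆)
    (fun a => by
      have h1 : ∀ c, ((((TrivSqZeroExt.inlAlgHom K (AlgB κ) (AlgB κ)).toLinearMap ∘ₗ genB κ +
        ((TrivSqZeroExt.inrHom (AlgB κ) (AlgB κ)).restrictScalars K ∘ₗ genB κ ∘ₗ
        (LieAlgebra.ad K 𝔤 x : 𝔤 →ₗ[K] 𝔤))) c).fst = genB κ c) := by simp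
      have h2 : ∀ c, ((((TrivSqZeroExt.inlAlgHom K (AlgB κ) (AlgB κ)).toLinearMap ∘ₗ genB κ +
        ((TrivSqZeroExt.inrHom (AlgB κ) (AlgB κ)).restrictScalars K ∘ₗ genB κ ∘ₗ
        (LieAlgebra.ad K 𝔤 x : 𝔤 →ₗ[K] 𝔤))) c).snd = genB κ ⁅x, c⁆) := by simp
      refine TrivSqZeroExt.ext ?_ ?_
      · rw [superBracket_fst κ _ (genB κ) h1, superBracket_genB, TrivSqZeroExt.fst_zero]
      · rw [superBracket_snd κ _ (genB κ) (genB κ ∘ₗ (LieAlgebra.ad K 𝔤 x : 𝔤 →ₗ[K] 𝔤)) h1 h2,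
          superBracket_lie, superBracket_genB, TrivSqZeroExt.snd_zero])

/-- The action of `x ∈ 𝔤` on `B`. -/
def actB (κ : InvForm K 𝔤) (x : 𝔤) : AlgB κ →ₗ[K] AlgB κ :=
  (TrivSqZeroExt.sndHom (AlgB κ) (AlgB κ)).restrictScalars K ∘ₗ (actHomB κ x).toLinearMap

theorem actB_genB (κ : InvForm K 𝔤) (x a : 𝔤) : actB κ x (genB κ a) = genB κ ⁅x, a⁆ := by
  simp [actB, actHomB, liftB_genB]

theorem actB_mul (κ : InvForm K 𝔤) (x : 𝔤) (s t : AlgB κ) :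
    actB κ x (s * t) = s * actB κ x t + actB κ x s * t := by
  have key : (TrivSqZeroExt.fstHom K (AlgB κ) (AlgB κ)).comp (actHomB κ x) = AlgHom.id K _ := by
    apply algHomB_ext
    intro a
    simp [actHomB, liftB_genB]
  have key' : ∀ s, (actHomB κ x s).fst = s := fun s => DFunLike.congr_fun key s
  simp [actB, key']

/-! ### The algebra `B ⊗ B` and its invariants -/

/-- The tensor product `B ⊗ B` of superalgebras: functions of a pair `(X, Y)` of points of `Π𝔤`
with `{X, X} = 0` and `{Y, Y} = 0`. -/
abbrev AlgBB (κ : InvForm K 𝔤) : Type _ := gradB κ ᵍ⊗[K] gradB κ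

/-- The linear functions of the first point `X`; `genX κ a` is `κ(a, X)`. -/
def genX (κ : InvForm K 𝔤) : 𝔤 →ₗ[K] AlgBB κ :=
  (GradedTensorProduct.includeLeft (gradB κ) (gradB κ)).toLinearMap ∘ₗ genB κ

/-- The linear functions of the second point `Y`; `genY κ a` is `κ(a, Y)`. -/
def genY (κ : InvForm K 𝔤) : 𝔤 →ₗ[K] AlgBB κ :=
  (GradedTensorProduct.includeRight (gradB κ) (gradB κ)).toLinearMap ∘ₗ genB κ

/-- The diagonal action of `x ∈ 𝔤` on `B ⊗ B`. -/
def actBB (κ : InvForm K 𝔤) (x : 𝔤) : AlgBB κ →ₗ[K] AlgBB κ :=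
  (GradedTensorProduct.of K (gradB κ) (gradB κ)).toLinearMap ∘ₗ
    (TensorProduct.map (actB κ x) LinearMap.id + TensorProduct.map LinearMap.id (actB κ x)) ∘ₗ
    (GradedTensorProduct.of K (gradB κ) (gradB κ)).symm.toLinearMap

/-- The space `E = (B ⊗ B)^𝔤` of invariants. -/
def invE (κ : InvForm K 𝔤) : Submodule K (AlgBB κ) := ⨅ x : 𝔤, LinearMap.ker (actBB κ x)

theorem genX_anti (κ : InvForm K 𝔤) (a c : 𝔤) : genX κ a * genX κ c = - (genX κ c * genX κ a) := by
  have h := congrArg (GradedTensorProduct.includeLeft (gradB κ) (gradB κ)) (genB_anti κ a c)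
  rw [map_add, map_mul, map_mul, map_zero] at h
  exact eq_neg_of_add_eq_zero_left h

theorem genY_anti (κ : InvForm K 𝔤) (a c : 𝔤) : genY κ a * genY κ c = - (genY κ c * genY κ a) := by
  have h := congrArg (GradedTensorProduct.includeRight (gradB κ) (gradB κ)) (genB_anti κ a c)
  rw [map_add, map_mul, map_mul, map_zero] at h
  exact eq_neg_of_add_eq_zero_left h

theorem genY_genX (κ : InvForm K 𝔤) (a c : 𝔤) : genY κ a * genX κ c = - (genX κ c * genY κ a) := by
  have h := GradedTensorProduct.tmul_coe_mul_coe_tmul (R := K) (gradB κ) (gradB κ) 1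
    ⟨genB κ a, genB_mem κ a⟩ ⟨genB κ c, genB_mem κ c⟩ 1
  have h' := GradedTensorProduct.tmul_one_mul_one_tmul (R := K) (gradB κ) (gradB κ)
    (genB κ c) (genB κ a)
  simp only [one_mul, mul_one] at h
  simp only [genX, genY, LinearMap.comp_apply, AlgHom.toLinearMap_apply,
    GradedTensorProduct.includeLeft_apply, GradedTensorProduct.includeRight_apply]
  rw [h', h]
  simp

/-- For `a ∈ 𝔤`, the function `κ(a, {X, Y})` of `X` and `Y`. -/
def genZ (κ : InvForm K 𝔤) : 𝔤 →ₗ[K] AlgBB κ := superBracket κ (genX κ) (genY κ)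

theorem genZ_comm (κ : InvForm K 𝔤) (a c : 𝔤) : genZ κ a * genZ κ c = genZ κ c * genZ κ a := by
  have h : ∀ p q r s : 𝔤, Commute (genX κ p * genY κ q) (genX κ r * genY κ s) := by
    intro p q r s
    have hX : Commute (genX κ p * genY κ q) (genX κ r) := by
      rw [commute_iff_eq, mul_assoc, genY_genX, mul_neg, ← mul_assoc, genX_anti, neg_mul, neg_neg,
        mul_assoc]
    have hY : Commute (genX κ p * genY κ q) (genY κ s) := by
      rw [commute_iff_eq, mul_assoc, genY_anti, mul_neg, ← mul_assoc, ← mul_assoc, genY_genX,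
        neg_mul]
    exact hX.mul_right hY
  change Commute _ _
  simp only [genZ, superBracket_apply]
  refine Commute.sum_left _ _ _ fun i _ => Commute.sum_left _ _ _ fun j _ => ?_
  refine Commute.sum_right _ _ _ fun k _ => Commute.sum_right _ _ _ fun l _ => ?_
  exact ((h _ _ _ _).smul_left _).smul_right _

/-! ### Invariants of `S𝔤` and the elements `F̂` -/

/-- The action of `x ∈ 𝔤` on `S𝔤` by the derivation extending the adjoint action. -/
def actS (K : Type*) [Field K] {𝔤 : Type*} [LieRing 𝔤] [LieAlgebra K 𝔤] (x : 𝔤) :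
    SymmetricAlgebra K 𝔤 →ₗ[K] SymmetricAlgebra K 𝔤 :=
  symDer (SymmetricAlgebra.ι K 𝔤 ∘ₗ (LieAlgebra.ad K 𝔤 x : 𝔤 →ₗ[K] 𝔤))

/-- The space `(S𝔤)^𝔤` of invariants. -/
def invS (K : Type*) [Field K] (𝔤 : Type*) [LieRing 𝔤] [LieAlgebra K 𝔤] :
    Submodule K (SymmetricAlgebra K 𝔤) := ⨅ x : 𝔤, LinearMap.ker (actS K x)

/-- The homogeneous component of degree `k` of `S𝔤`. -/
def homogS (K : Type*) [Field K] (𝔤 : Type*) [LieRing 𝔤] [LieAlgebra K 𝔤] (k : ℕ) :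
    Submodule K (SymmetricAlgebra K 𝔤) := LinearMap.range (SymmetricAlgebra.ι K 𝔤) ^ k

/-- The derivative `∂_v` of elements of `S𝔤` in the direction of `v ∈ 𝔤`. Here `a ∈ 𝔤` is regarded
as the linear function `κ(a, ·)` on `𝔤`, hence `∂_v a = κ(a, v)`. -/
def dirDeriv (κ : InvForm K 𝔤) (v : 𝔤) : SymmetricAlgebra K 𝔤 →ₗ[K] SymmetricAlgebra K 𝔤 :=
  symDer ((Algebra.linearMap K (SymmetricAlgebra K 𝔤)) ∘ₗ κ.form.flip v)

/-- `F ↦ F({X, Y})`. -/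
def evalZ (κ : InvForm K 𝔤) : SymmetricAlgebra K 𝔤 →ₐ[K] AlgBB κ :=
  symLift (genZ κ) (genZ_comm κ)

/-- `F ↦ dF({X, Y})(P)`, for the point `P = ∑ i, b i ⊗ f (b' i)`. -/
def dEvalZ (κ : InvForm K 𝔤) (f : 𝔤 →ₗ[K] AlgBB κ) (F : SymmetricAlgebra K 𝔤) : AlgBB κ :=
  ∑ i, evalZ κ (dirDeriv κ (bas K 𝔤 i) F) * f (dualBas κ i)

/-- `F̂(X, Y) = d²F({X, Y})(X ⊗ Y)`. -/
def hat (κ : InvForm K 𝔤) (F : SymmetricAlgebra K 𝔤) : AlgBB κ :=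
  ∑ i, ∑ j, evalZ κ (dirDeriv κ (bas K 𝔤 i) (dirDeriv κ (bas K 𝔤 j) F)) *
    (genX κ (dualBas κ i) * genY κ (dualBas κ j))

end SuperLie

end

/-!
Write `Z = {X, Y}`. Since `{X, X} = 0`, the Jacobi identity gives `{X, Z} = 0`
(`sum_superBracket_lie_mul`), so the odd vector field `{X, ·}` on `𝔤`, being a combination of the
derivations `actS`, kills every polynomial at `Z` (`sum_actS_mul`). For an invariant `F` the
commutator of `actS x` with `∂_v` is `∂_⁅x, v⁆`, hence

* applied to `∂_v F` this says `dF(Z)({X, v}) = 0` for all `v`; contracting with `v = Y` and using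
  Euler's identity one gets `k F(Z) = dF(Z)(Z) = 0`, where `k` is the degree of `F`;
* applied to `∂_v ∂_w F` and contracted with `v = Y`, `w = X` it expresses `d²F(Z)(Z, X)` through
  `d²F(Z)(Y, {X, X}) = 0`; by Euler's identity, `(k - 1) dF(Z)(X) = 0`.

This leaves `dF(Z)(X)` for `k = 1`, where `F` is a central element of `𝔤`, that is, zero. The
statement about `Y` follows by exchanging the two points, as `{X, Y} = {Y, X}`. To allow for the
exchange, these facts are stated for two odd points `f`, `g` with values in any algebra.

By the Leibniz rule (`hat_mul`), the element attached to `F H` is a sum of terms each having one of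
`F(Z)`, `H(Z)`, `dF(Z)(X)`, `dH(Z)(X)` as a factor, so it vanishes. Finally `F̂` is invariant
(`hat_mem_invE`) because `𝔤` acts on `B ⊗ B` by derivations and all contractions involved are
contractions with the invariant element `∑ i, b i ⊗ b' i`.
-/

noncomputable section

namespace SuperLie

/-! ### Derivations of the symmetric algebra -/

section SymmetricAlgebra

variable {K : Type*} [Field K] {M : Type*} [AddCommGroup M] [Module K M]

/-- Derivations of `S(M)` along a homomorphism `e` into a not necessarily commutative algebra are
determined by their values on generators. -/
theorem eq_of_leibniz {T : Type*} [Ring T] [Algebra K T] (e : SymmetricAlgebra K M →ₐ[K] T)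
    (D D' : SymmetricAlgebra K M →ₗ[K] T)
    (hD : ∀ F G, D (F * G) = e F * D G + e G * D F)
    (hD' : ∀ F G, D' (F * G) = e F * D' G + e G * D' F)
    (h : ∀ m, D (SymmetricAlgebra.ι K M m) = D' (SymmetricAlgebra.ι K M m))
    (F : SymmetricAlgebra K M) : D F = D' F := by
  have h1 : D 1 = 0 := by simpa using hD 1 1
  have h1' : D' 1 = 0 := by simpa using hD' 1 1
  induction F using SymmetricAlgebra.induction with
  | algebraMap r => rw [Algebra.algebraMap_eq_smul_one, map_smul, map_smul, h1, h1']
  | ι m => exact h m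
  | mul F G hF hG => rw [hD, hD', hF, hG]
  | add F G hF hG => rw [map_add, map_add, hF, hG]

theorem map_mul_map_comm {T : Type*} [Ring T] [Algebra K T]
    (e : SymmetricAlgebra K M →ₐ[K] T) (F G : SymmetricAlgebra K M) : e F * e G = e G * e F := by
  rw [← map_mul, mul_comm, map_mul]

theorem symDer_algebraMap (φ : M →ₗ[K] SymmetricAlgebra K M) (r : K) :
    symDer φ (algebraMap K _ r) = 0 := by
  have h : symDer φ 1 = 0 := by simpa using symDer_mul φ 1 1
  rw [Algebra.algebraMap_eq_smul_one, map_smul, h, smul_zero]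

theorem symDer_add (φ ψ : M →ₗ[K] SymmetricAlgebra K M) :
    symDer (φ + ψ) = symDer φ + symDer ψ := by
  ext F
  refine eq_of_leibniz (AlgHom.id K _) _ (symDer φ + symDer ψ) ?_ ?_ ?_ F
  · intro F G; simp [symDer_mul]
  · intro F G; simp [symDer_mul]; ring
  · intro m; simp [symDer_ι]

theorem symDer_smul (c : K) (φ : M →ₗ[K] SymmetricAlgebra K M) :
    symDer (c • φ) = c • symDer φ := by
  ext F
  refine eq_of_leibniz (AlgHom.id K _) _ (c • symDer φ) ?_ ?_ ?_ F
  · intro F G; simp [symDer_mul]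
  · intro F G; simp [symDer_mul]
  · intro m; simp [symDer_ι]

theorem symDer_commutator (φ ψ χ : M →ₗ[K] SymmetricAlgebra K M)
    (h : ∀ m, symDer φ (ψ m) = symDer ψ (φ m) + χ m) (F : SymmetricAlgebra K M) :
    symDer φ (symDer ψ F) = symDer ψ (symDer φ F) + symDer χ F := by
  have key := eq_of_leibniz (AlgHom.id K _) (symDer φ ∘ₗ symDer ψ - symDer ψ ∘ₗ symDer φ)
    (symDer χ) ?_ ?_ ?_ F
  · simpa [sub_eq_iff_eq_add'] using key
  · intro F G; simp [symDer_mul]; ring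
  · intro F G; simp [symDer_mul]
  · intro m; simp [symDer_ι, h]

end SymmetricAlgebra

/-! ### Euler's identity and directional derivatives of invariants -/

section Invariants

variable {K : Type*} [Field K] {𝔤 : Type*} [LieRing 𝔤] [LieAlgebra K 𝔤]

/-- Euler's identity: the derivation that fixes the generators multiplies elements of degree `k`
by `k`. -/
theorem symDer_ι_of_mem_homogS {k : ℕ} {F : SymmetricAlgebra K 𝔤} (hF : F ∈ homogS K 𝔤 k) :
    symDer (SymmetricAlgebra.ι K 𝔤) F = (k : K) • F := by
  rw [homogS] at hF
  induction hF using Submodule.pow_induction_on_left' with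
  | algebraMap r => simp [symDer_algebraMap]
  | add F G i _ _ hF hG => rw [map_add, hF, hG, smul_add]
  | mem_mul m hm i F _ hF =>
    obtain ⟨a, rfl⟩ := hm
    rw [symDer_mul, symDer_ι, hF]
    push_cast
    rw [add_smul, one_smul, mul_smul_comm, mul_comm F]

/-- The derivative `∂_v`, as a linear function of the direction `v`. -/
def dirDerivₗ (κ : InvForm K 𝔤) :
    𝔤 →ₗ[K] SymmetricAlgebra K 𝔤 →ₗ[K] SymmetricAlgebra K 𝔤 where
  toFun := dirDeriv κ
  map_add' v w := by
    rw [dirDeriv, dirDeriv, dirDeriv, ← symDer_add, map_add, LinearMap.comp_add]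
  map_smul' c v := by
    rw [dirDeriv, dirDeriv, RingHom.id_apply, ← symDer_smul, map_smul, LinearMap.comp_smul]

theorem dirDeriv_ι (κ : InvForm K 𝔤) (v a : 𝔤) :
    dirDeriv κ v (SymmetricAlgebra.ι K 𝔤 a) = algebraMap K _ (κ.form a v) := by
  simp [dirDeriv, symDer_ι]

theorem dirDeriv_mul (κ : InvForm K 𝔤) (v : 𝔤) (F G : SymmetricAlgebra K 𝔤) :
    dirDeriv κ v (F * G) = F * dirDeriv κ v G + G * dirDeriv κ v F :=
  symDer_mul _ F G

/-- The commutator of the action of `x` with `∂_v` is `∂_⁅x, v⁆`. -/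
theorem actS_dirDeriv (κ : InvForm K 𝔤) (x v : 𝔤) (F : SymmetricAlgebra K 𝔤) :
    actS K x (dirDeriv κ v F) = dirDeriv κ v (actS K x F) + dirDeriv κ ⁅x, v⁆ F := by
  refine symDer_commutator _ _ _ (fun a => ?_) F
  simp only [LinearMap.comp_apply, Algebra.linearMap_apply, symDer_algebraMap, symDer_ι,
    ← map_add]
  simp [κ.lieInvariant x a v]

theorem symDer_ι_dirDeriv (κ : InvForm K 𝔤) {k : ℕ} {F : SymmetricAlgebra K 𝔤}
    (hF : F ∈ homogS K 𝔤 k) (v : 𝔤) :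
    symDer (SymmetricAlgebra.ι K 𝔤) (dirDeriv κ v F) = ((k : K) - 1) • dirDeriv κ v F := by
  have h : dirDeriv κ v (symDer (SymmetricAlgebra.ι K 𝔤) F)
      = symDer (SymmetricAlgebra.ι K 𝔤) (dirDeriv κ v F) + dirDeriv κ v F := by
    refine symDer_commutator _ _ _ (fun a => ?_) F
    simp [symDer_ι, symDer_algebraMap]
  rw [symDer_ι_of_mem_homogS hF, map_smul] at h
  rw [sub_smul, one_smul, h, add_sub_cancel_right]

theorem actS_eq_zero_of_mem_invS {F : SymmetricAlgebra K 𝔤} (hF : F ∈ invS K 𝔤) (x : 𝔤) :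
    actS K x F = 0 := by
  simpa using (Submodule.mem_iInf _).1 hF x

theorem actS_dirDeriv_of_mem_invS (κ : InvForm K 𝔤) {F : SymmetricAlgebra K 𝔤}
    (hF : F ∈ invS K 𝔤) (x v : 𝔤) :
    actS K x (dirDeriv κ v F) = dirDeriv κ ⁅x, v⁆ F := by
  rw [actS_dirDeriv, actS_eq_zero_of_mem_invS hF, map_zero, zero_add]

theorem actS_dirDeriv_dirDeriv_of_mem_invS (κ : InvForm K 𝔤) {F : SymmetricAlgebra K 𝔤}
    (hF : F ∈ invS K 𝔤) (x v w : 𝔤) :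
    actS K x (dirDeriv κ v (dirDeriv κ w F))
      = dirDeriv κ v (dirDeriv κ ⁅x, w⁆ F) + dirDeriv κ ⁅x, v⁆ (dirDeriv κ w F) := by
  rw [actS_dirDeriv, actS_dirDeriv_of_mem_invS κ hF]

/-- A Lie algebra with trivial center has no nonzero linear invariants. -/
theorem eq_zero_of_mem_invS_of_mem_homogS_one (hZ : LieAlgebra.center K 𝔤 = ⊥)
    {F : SymmetricAlgebra K 𝔤} (hF : F ∈ invS K 𝔤) (h1 : F ∈ homogS K 𝔤 1) : F = 0 := by
  rw [homogS, pow_one] at h1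
  obtain ⟨a, rfl⟩ := h1
  suffices a ∈ LieAlgebra.center K 𝔤 by
    rw [hZ, LieSubmodule.mem_bot] at this
    rw [this, map_zero]
  rw [LieModule.mem_maxTrivSubmodule]
  intro x
  have h := actS_eq_zero_of_mem_invS hF x
  -- Linear forms separate points of `𝔤`, and each of them extends to `S𝔤`.
  rw [actS, symDer_ι] at h
  rw [← Module.forall_dual_apply_eq_zero_iff K]
  intro l
  have h' := congrArg (SymmetricAlgebra.lift l) h
  simpa using h'

end Invariants

/-! ### Pairs of odd points -/

section OddPoints

variable {K : Type*} [Field K] {𝔤 : Type*} [LieRing 𝔤] [LieAlgebra K 𝔤] [FiniteDimensional K 𝔤]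
  {T : Type*} [Ring T] [Algebra K T]

/-- The value at `{X, Y}` of a `T`-valued linear function `l`, computed by expanding
`{X, Y} = ∑ i, ∑ j, ⁅b i, b j⁆ ⊗ x i * y j` and from the coordinates of `{X, Y}`. -/
theorem sum_bracket_mul (κ : InvForm K 𝔤) (l f g : 𝔤 →ₗ[K] T) :
    ∑ i, ∑ j, l ⁅bas K 𝔤 i, bas K 𝔤 j⁆ * (f (dualBas κ i) * g (dualBas κ j))
      = ∑ k, l (bas K 𝔤 k) * superBracket κ f g (dualBas κ k) := by
  have h : ∀ i j, l ⁅bas K 𝔤 i, bas K 𝔤 j⁆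
      = ∑ k, κ.form (dualBas κ k) ⁅bas K 𝔤 i, bas K 𝔤 j⁆ • l (bas K 𝔤 k) := by
    intro i j
    conv_lhs => rw [sum_bas κ ⁅bas K 𝔤 i, bas K 𝔤 j⁆]
    simp
  simp_rw [h, superBracket_apply, Finset.sum_mul, Finset.mul_sum, smul_mul_assoc, mul_smul_comm]
  rw [Finset.sum_comm_cycle]

/-- `{Y, X} = {X, Y}` for odd points. -/
theorem superBracket_symm (κ : InvForm K 𝔤) (f g : 𝔤 →ₗ[K] T)
    (h : ∀ a c, g a * f c = -(f c * g a)) : superBracket κ g f = superBracket κ f g := by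
  ext a
  rw [superBracket_apply, superBracket_apply, Finset.sum_comm]
  refine Finset.sum_congr rfl fun i _ => Finset.sum_congr rfl fun j _ => ?_
  rw [h, ← lie_skew, map_neg, neg_smul, smul_neg, neg_neg]

/-- If `{X, X} = 0` then `{X, {X, Y}} = 0`. This is the Jacobi identity
`2 {X, {X, Y}} = {{X, X}, Y}`. -/
theorem sum_superBracket_lie_mul [CharZero K] (κ : InvForm K 𝔤) (f g : 𝔤 →ₗ[K] T)
    (hf : ∀ a c, f a * f c = -(f c * f a)) (hgf : ∀ a c, g a * f c = -(f c * g a))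
    (hff : ∀ a, superBracket κ f f a = 0) (a : 𝔤) :
    ∑ p, superBracket κ f g ⁅bas K 𝔤 p, a⁆ * f (dualBas κ p) = 0 := by
  -- `{X, {X, u}} = 0` for a fixed `u ∈ 𝔤`: the sum `s` equals its own antisymmetrization.
  have key : ∀ u : 𝔤, ∑ p, ∑ i, κ.form a ⁅bas K 𝔤 p, ⁅bas K 𝔤 i, u⁆⁆ •
      (f (dualBas κ p) * f (dualBas κ i)) = 0 := by
    intro u
    set s := ∑ p, ∑ i, κ.form a ⁅bas K 𝔤 p, ⁅bas K 𝔤 i, u⁆⁆ •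
      (f (dualBas κ p) * f (dualBas κ i)) with hs
    have h1 : s = -∑ p, ∑ i, κ.form a ⁅bas K 𝔤 i, ⁅bas K 𝔤 p, u⁆⁆ •
        (f (dualBas κ p) * f (dualBas κ i)) := by
      rw [hs, Finset.sum_comm, ← Finset.sum_neg_distrib]
      refine Finset.sum_congr rfl fun p _ => ?_
      rw [← Finset.sum_neg_distrib]
      refine Finset.sum_congr rfl fun i _ => ?_
      rw [hf, smul_neg]
    have h2 : s + s = 0 := by
      nth_rw 2 [h1]
      rw [hs, ← sub_eq_add_neg, ← Finset.sum_sub_distrib]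
      simp_rw [← Finset.sum_sub_distrib, ← sub_smul, ← map_sub, ← lie_lie, ← lie_skew _ u]
      have h3 := sum_bracket_mul κ
        ((κ.form a ∘ₗ (-(LieAlgebra.ad K 𝔤 u : 𝔤 →ₗ[K] 𝔤))).smulRight (1 : T)) f f
      simpa only [LinearMap.smulRight_apply, LinearMap.comp_apply, LinearMap.neg_apply,
        LieHom.coe_toLinearMap, LieAlgebra.ad_apply, smul_one_mul, hff, mul_zero,
        Finset.sum_const_zero] using h3
    have h3 : (2 : K) • s = 0 := by rw [two_smul, h2]
    exact (smul_eq_zero.1 h3).resolve_left two_ne_zero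
  have h1 : ∀ p i j, κ.form ⁅bas K 𝔤 p, a⁆ ⁅bas K 𝔤 i, bas K 𝔤 j⁆ •
      (f (dualBas κ i) * g (dualBas κ j)) * f (dualBas κ p)
      = -(κ.form a ⁅bas K 𝔤 p, ⁅bas K 𝔤 i, bas K 𝔤 j⁆⁆ •
        (f (dualBas κ p) * f (dualBas κ i))) * g (dualBas κ j) := by
    intro p i j
    rw [κ.lieInvariant, smul_mul_assoc, mul_assoc, hgf, mul_neg, ← mul_assoc, hf]
    simp
  simp_rw [superBracket_apply, Finset.sum_mul, h1]
  rw [Finset.sum_comm_cycle]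
  refine Finset.sum_eq_zero fun j _ => ?_
  simp_rw [← Finset.sum_mul, Finset.sum_neg_distrib]
  rw [key, neg_zero, zero_mul]

/-- Euler's identity `dF(Z)(Z) = (Eu F)(Z)`, where `Eu` is the derivation that fixes the
generators. -/
theorem sum_dirDeriv_mul (κ : InvForm K 𝔤) (e : SymmetricAlgebra K 𝔤 →ₐ[K] T)
    (F : SymmetricAlgebra K 𝔤) :
    ∑ i, e (dirDeriv κ (bas K 𝔤 i) F) * e (SymmetricAlgebra.ι K 𝔤 (dualBas κ i))
      = e (symDer (SymmetricAlgebra.ι K 𝔤) F) := by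
  have h := eq_of_leibniz e
    (∑ i, LinearMap.mulRight K (e (SymmetricAlgebra.ι K 𝔤 (dualBas κ i))) ∘ₗ
      e.toLinearMap ∘ₗ dirDeriv κ (bas K 𝔤 i))
    (e.toLinearMap ∘ₗ symDer (SymmetricAlgebra.ι K 𝔤)) ?_ ?_ ?_ F
  · simpa using h
  · intro F G
    simp [dirDeriv_mul, add_mul, Finset.sum_add_distrib, Finset.mul_sum, mul_assoc]
  · intro F G; simp [symDer_mul]
  · intro a
    conv_rhs => rw [sum_dualBas κ a]
    simp [dirDeriv_ι, symDer_ι, Algebra.algebraMap_eq_smul_one]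

variable {κ : InvForm K 𝔤} {e : SymmetricAlgebra K 𝔤 →ₐ[K] T} {f g : 𝔤 →ₗ[K] T}

/-- Euler's identity at the point `{X, Y}`, with its coordinates written out. -/
theorem sum_dirDeriv_bracket_mul
    (he : ∀ a, e (SymmetricAlgebra.ι K 𝔤 a) = superBracket κ f g a) (G : SymmetricAlgebra K 𝔤) :
    ∑ i, ∑ j, e (dirDeriv κ ⁅bas K 𝔤 i, bas K 𝔤 j⁆ G) * (f (dualBas κ i) * g (dualBas κ j))
      = e (symDer (SymmetricAlgebra.ι K 𝔤) G) := by
  rw [← sum_dirDeriv_mul κ e G]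
  simp_rw [he]
  exact sum_bracket_mul κ (e.toLinearMap ∘ₗ (dirDerivₗ κ).flip G) f g

/-- The odd vector field `{X, ·}` kills every polynomial on `𝔤` at `Z = {X, Y}`: on linear functions
this is `{X, Z} = 0`, and the left-hand side is a derivation along evaluation at `Z`. -/
theorem sum_actS_mul [CharZero K]
    (he : ∀ a, e (SymmetricAlgebra.ι K 𝔤 a) = superBracket κ f g a)
    (hf : ∀ a c, f a * f c = -(f c * f a)) (hgf : ∀ a c, g a * f c = -(f c * g a))
    (hff : ∀ a, superBracket κ f f a = 0) (G : SymmetricAlgebra K 𝔤) :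
    ∑ p, e (actS K (bas K 𝔤 p) G) * f (dualBas κ p) = 0 := by
  have h := eq_of_leibniz e
    (∑ p, LinearMap.mulRight K (f (dualBas κ p)) ∘ₗ e.toLinearMap ∘ₗ actS K (bas K 𝔤 p))
    0 ?_ ?_ ?_ G
  · simpa using h
  · intro F G
    simp [actS, symDer_mul, add_mul, Finset.sum_add_distrib, Finset.mul_sum, mul_assoc]
  · intro F G; simp
  · intro a
    simpa [actS, symDer_ι, he] using sum_superBracket_lie_mul κ f g hf hgf hff a

/-- An invariant of positive degree vanishes at `{X, Y}`. -/
theorem eval_superBracket_eq_zero [CharZero K]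
    (he : ∀ a, e (SymmetricAlgebra.ι K 𝔤 a) = superBracket κ f g a)
    (hf : ∀ a c, f a * f c = -(f c * f a)) (hgf : ∀ a c, g a * f c = -(f c * g a))
    (hff : ∀ a, superBracket κ f f a = 0) {k : ℕ} (hk : k ≠ 0) {F : SymmetricAlgebra K 𝔤}
    (hF : F ∈ invS K 𝔤) (hFk : F ∈ homogS K 𝔤 k) : e F = 0 := by
  have h := sum_dirDeriv_bracket_mul he F
  rw [symDer_ι_of_mem_homogS hFk, map_smul, Finset.sum_comm] at h
  simp_rw [← mul_assoc, ← Finset.sum_mul, ← actS_dirDeriv_of_mem_invS κ hF,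
    sum_actS_mul he hf hgf hff, zero_mul, Finset.sum_const_zero] at h
  exact (smul_eq_zero.1 h.symm).resolve_left (Nat.cast_ne_zero.2 hk)

/-- The differential at `{X, Y}` of an invariant of degree different from one vanishes on `X`. -/
theorem sum_eval_dirDeriv_mul_eq_zero [CharZero K]
    (he : ∀ a, e (SymmetricAlgebra.ι K 𝔤 a) = superBracket κ f g a)
    (hf : ∀ a c, f a * f c = -(f c * f a)) (hgf : ∀ a c, g a * f c = -(f c * g a))
    (hff : ∀ a, superBracket κ f f a = 0) {k : ℕ} (hk : k ≠ 1) {F : SymmetricAlgebra K 𝔤}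
    (hF : F ∈ invS K 𝔤) (hFk : F ∈ homogS K 𝔤 k) :
    ∑ q, e (dirDeriv κ (bas K 𝔤 q) F) * f (dualBas κ q) = 0 := by
  -- `sum_actS_mul` for `∂_j ∂_q F`, contracted with the second point in `j` and the first in `q`.
  have h1 : ∑ q, ∑ j, (∑ p, e (actS K (bas K 𝔤 p)
      (dirDeriv κ (bas K 𝔤 j) (dirDeriv κ (bas K 𝔤 q) F))) * f (dualBas κ p)) *
      (g (dualBas κ j) * f (dualBas κ q)) = 0 := by
    simp_rw [sum_actS_mul he hf hgf hff, zero_mul, Finset.sum_const_zero]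
  -- The terms with `{X, X}`.
  have h2 : ∑ q, ∑ j, ∑ p, e (dirDeriv κ (bas K 𝔤 j) (dirDeriv κ ⁅bas K 𝔤 p, bas K 𝔤 q⁆ F)) *
      f (dualBas κ p) * (g (dualBas κ j) * f (dualBas κ q)) = 0 := by
    simp_rw [hgf, mul_neg, ← mul_assoc, mul_assoc _ (f _) (f _), Finset.sum_neg_distrib]
    rw [Finset.sum_comm, neg_eq_zero]
    refine Finset.sum_eq_zero fun j _ => ?_
    rw [Finset.sum_comm]
    simp_rw [← Finset.sum_mul]
    have h := sum_bracket_mul κ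
      (e.toLinearMap ∘ₗ dirDeriv κ (bas K 𝔤 j) ∘ₗ (dirDerivₗ κ).flip F) f f
    simp only [hff, mul_zero, Finset.sum_const_zero] at h
    exact (congrArg (· * g (dualBas κ j)) h).trans (zero_mul _)
  -- The terms with `{X, Y}`.
  have h3 : ∑ q, ∑ j, ∑ p, e (dirDeriv κ ⁅bas K 𝔤 p, bas K 𝔤 j⁆ (dirDeriv κ (bas K 𝔤 q) F)) *
      f (dualBas κ p) * (g (dualBas κ j) * f (dualBas κ q))
      = ((k : K) - 1) • ∑ q, e (dirDeriv κ (bas K 𝔤 q) F) * f (dualBas κ q) := by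
    rw [Finset.smul_sum]
    refine Finset.sum_congr rfl fun q _ => ?_
    rw [← smul_mul_assoc, ← map_smul, ← symDer_ι_dirDeriv κ hFk, ← sum_dirDeriv_bracket_mul he,
      Finset.sum_comm]
    simp_rw [Finset.sum_mul, mul_assoc]
  simp_rw [actS_dirDeriv_dirDeriv_of_mem_invS κ hF, map_add, add_mul, Finset.sum_add_distrib,
    add_mul, Finset.sum_add_distrib, Finset.sum_mul, h2, h3, zero_add] at h1
  exact (smul_eq_zero.1 h1).resolve_left (sub_ne_zero.2 (by exact_mod_cast hk))

end OddPoints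

/-! ### The action of `𝔤` on `B ⊗ B` -/

section Action

variable {K : Type*} [Field K] {𝔤 : Type*} [LieRing 𝔤] [LieAlgebra K 𝔤] [FiniteDimensional K 𝔤]

theorem actB_one (κ : InvForm K 𝔤) (x : 𝔤) : actB κ x 1 = 0 := by
  simpa using actB_mul κ x 1 1

theorem actB_mem_gradB (κ : InvForm K 𝔤) (x : 𝔤) {n : ℕ} {t : AlgB κ} (ht : t ∈ gradB κ n) :
    actB κ x t ∈ gradB κ n := by
  induction ht using Submodule.pow_induction_on_left' with
  | algebraMap r =>
    rw [Algebra.algebraMap_eq_smul_one, map_smul, actB_one, smul_zero]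
    exact zero_mem _
  | add s t i _ _ hs ht => rw [map_add]; exact add_mem hs ht
  | mem_mul m hm i t ht ih =>
    obtain ⟨a, rfl⟩ := hm
    rw [actB_mul, actB_genB, Nat.succ_eq_add_one, add_comm i 1]
    exact add_mem (SetLike.mul_mem_graded (genB_mem κ _) ih)
      (SetLike.mul_mem_graded (genB_mem κ _) ht)

/-- Products of homogeneous elements span `B ⊗ B`. -/
theorem linearMap_ext_tmul (κ : InvForm K 𝔤) {V : Type*} [AddCommGroup V] [Module K V]
    {D D' : AlgBB κ →ₗ[K] V}
    (h : ∀ (m : ℕ) (s : gradB κ m) (t : AlgB κ),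
      D (GradedTensorProduct.tmul K (s : AlgB κ) t)
        = D' (GradedTensorProduct.tmul K (s : AlgB κ) t)) : D = D' := by
  apply GradedTensorProduct.hom_ext
  refine TensorProduct.ext' fun s t => ?_
  induction s using DirectSum.Decomposition.inductionOn (gradB κ) with
  | zero => rw [TensorProduct.zero_tmul, map_zero, map_zero]
  | homogeneous s => exact h _ s t
  | add s s' hs hs' => rw [TensorProduct.add_tmul, map_add, map_add, hs, hs']

theorem actBB_tmul (κ : InvForm K 𝔤) (x : 𝔤) (s t : AlgB κ) :
    actBB κ x (GradedTensorProduct.tmul K s t)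
      = GradedTensorProduct.tmul K (actB κ x s) t + GradedTensorProduct.tmul K s (actB κ x t) :=
  rfl

theorem gradedTensor_add_tmul (κ : InvForm K 𝔤) (s s' t : AlgB κ) :
    (GradedTensorProduct.tmul K (s + s') t : AlgBB κ)
      = GradedTensorProduct.tmul K s t + GradedTensorProduct.tmul K s' t :=
  TensorProduct.add_tmul s s' t

theorem gradedTensor_tmul_add (κ : InvForm K 𝔤) (s t t' : AlgB κ) :
    (GradedTensorProduct.tmul K s (t + t') : AlgBB κ)
      = GradedTensorProduct.tmul K s t + GradedTensorProduct.tmul K s t' :=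
  TensorProduct.tmul_add s t t'

theorem actBB_one (κ : InvForm K 𝔤) (x : 𝔤) : actBB κ x 1 = 0 := by
  have h := actBB_tmul κ x 1 1
  rw [actB_one] at h
  refine h.trans ?_
  rw [GradedTensorProduct.tmul, GradedTensorProduct.tmul]
  simp

theorem genX_mul_tmul (κ : InvForm K 𝔤) (a : 𝔤) {m : ℕ} (s : gradB κ m) (t : AlgB κ) :
    genX κ a * GradedTensorProduct.tmul K (s : AlgB κ) t
      = GradedTensorProduct.tmul K (genB κ a * s) t :=
  GradedTensorProduct.tmul_one_mul_coe_tmul (R := K) (gradB κ) (gradB κ) (genB κ a) s t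

theorem genY_mul_tmul (κ : InvForm K 𝔤) (a : 𝔤) {m : ℕ} (s : gradB κ m) (t : AlgB κ) :
    genY κ a * GradedTensorProduct.tmul K (s : AlgB κ) t
      = (-1 : ℤˣ) ^ m • GradedTensorProduct.tmul K (s : AlgB κ) (genB κ a * t) := by
  have h := GradedTensorProduct.tmul_coe_mul_coe_tmul (R := K) (gradB κ) (gradB κ) 1
    ⟨genB κ a, genB_mem κ a⟩ s t
  rw [one_mul, one_mul] at h
  exact h

/-- `x ∈ 𝔤` acts on `B ⊗ B` by an even derivation; here this is stated for left multiplication by a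
generator. -/
theorem actBB_genX_mul (κ : InvForm K 𝔤) (x a : 𝔤) (t : AlgBB κ) :
    actBB κ x (genX κ a * t) = genX κ ⁅x, a⁆ * t + genX κ a * actBB κ x t := by
  have h : actBB κ x ∘ₗ LinearMap.mulLeft K (genX κ a)
      = LinearMap.mulLeft K (genX κ ⁅x, a⁆) + LinearMap.mulLeft K (genX κ a) ∘ₗ actBB κ x := by
    refine linearMap_ext_tmul κ fun m s t => ?_
    have hs := genX_mul_tmul κ a ⟨_, actB_mem_gradB κ x s.2⟩ t
    simp only [LinearMap.comp_apply, LinearMap.add_apply, LinearMap.mulLeft_apply, actBB_tmul,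
      genX_mul_tmul, mul_add, actB_mul, actB_genB, hs, gradedTensor_add_tmul]
    abel
  exact LinearMap.congr_fun h t

theorem actBB_genY_mul (κ : InvForm K 𝔤) (x a : 𝔤) (t : AlgBB κ) :
    actBB κ x (genY κ a * t) = genY κ ⁅x, a⁆ * t + genY κ a * actBB κ x t := by
  have h : actBB κ x ∘ₗ LinearMap.mulLeft K (genY κ a)
      = LinearMap.mulLeft K (genY κ ⁅x, a⁆) + LinearMap.mulLeft K (genY κ a) ∘ₗ actBB κ x := by
    refine linearMap_ext_tmul κ fun m s t => ?_
    have hs := genY_mul_tmul κ a ⟨_, actB_mem_gradB κ x s.2⟩ t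
    have hu : ∀ u : AlgBB κ, actBB κ x ((-1 : ℤˣ) ^ m • u) = (-1 : ℤˣ) ^ m • actBB κ x u := by
      intro u
      rw [Units.smul_def, Units.smul_def, map_zsmul]
    simp only [LinearMap.comp_apply, LinearMap.add_apply, LinearMap.mulLeft_apply, actBB_tmul,
      genY_mul_tmul, actB_mul, actB_genB, hs, hu, map_add,
      gradedTensor_tmul_add, smul_add]
    abel
  exact LinearMap.congr_fun h t

theorem actBB_evalZ_mul (κ : InvForm K 𝔤) (x : 𝔤) (F : SymmetricAlgebra K 𝔤) :
    ∀ t : AlgBB κ, actBB κ x (evalZ κ F * t)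
      = evalZ κ (actS K x F) * t + evalZ κ F * actBB κ x t := by
  induction F using SymmetricAlgebra.induction with
  | algebraMap r =>
    intro t
    rw [actS, symDer_algebraMap, map_zero, zero_mul, zero_add, AlgHom.commutes,
      ← Algebra.smul_def, ← Algebra.smul_def, map_smul]
  | ι a =>
    intro t
    rw [actS, symDer_ι, evalZ, symLift_ι, LinearMap.comp_apply, symLift_ι]
    have h := superBracket_lie κ (genX κ) (genY κ) x a
    rw [genZ, LieAlgebra.ad_apply, ← h]
    simp_rw [superBracket_apply, Finset.sum_mul, map_sum, smul_mul_assoc, map_smul, mul_assoc,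
      actBB_genX_mul, actBB_genY_mul, LinearMap.comp_apply]
    simp [mul_add, add_mul, Finset.sum_add_distrib, mul_assoc, Finset.sum_mul, add_assoc]
  | mul F G hF hG =>
    intro t
    rw [actS] at hF hG ⊢
    rw [map_mul (evalZ κ), mul_assoc, hF, hG, symDer_mul, map_add, map_mul, map_mul, mul_add,
      add_mul, map_mul_map_comm (evalZ κ) G, mul_assoc, mul_assoc, mul_assoc, ← add_assoc,
      add_comm (evalZ κ F * _)]
  | add F G hF hG =>
    intro t
    simp only [map_add, add_mul, hF, hG]
    abel

/-- The element `F̂` of an invariant `F` is invariant. -/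
theorem hat_mem_invE (κ : InvForm K 𝔤) {F : SymmetricAlgebra K 𝔤} (hF : F ∈ invS K 𝔤) :
    hat κ F ∈ invE κ := by
  rw [invE, Submodule.mem_iInf]
  intro x
  rw [LinearMap.mem_ker, hat]
  have hY : ∀ a, actBB κ x (genY κ a) = genY κ ⁅x, a⁆ := by
    intro a
    simpa [actBB_one] using actBB_genY_mul κ x a 1
  have e1 : ∀ j, ∑ i, evalZ κ (dirDeriv κ (bas K 𝔤 i) (dirDeriv κ (bas K 𝔤 j) F)) *
      (genX κ ⁅x, dualBas κ i⁆ * genY κ (dualBas κ j))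
      = -∑ i, evalZ κ (dirDeriv κ ⁅x, bas K 𝔤 i⁆ (dirDeriv κ (bas K 𝔤 j) F)) *
      (genX κ (dualBas κ i) * genY κ (dualBas κ j)) := by
    intro j
    exact casimir_invariant κ ((LinearMap.mul K (AlgBB κ)).compl₁₂
      ((evalZ κ).toLinearMap ∘ₗ (dirDerivₗ κ).flip (dirDeriv κ (bas K 𝔤 j) F))
      (LinearMap.mulRight K (genY κ (dualBas κ j)) ∘ₗ genX κ)) x
  have e2 : ∀ i, ∑ j, evalZ κ (dirDeriv κ (bas K 𝔤 i) (dirDeriv κ (bas K 𝔤 j) F)) *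
      (genX κ (dualBas κ i) * genY κ ⁅x, dualBas κ j⁆)
      = -∑ j, evalZ κ (dirDeriv κ (bas K 𝔤 i) (dirDeriv κ ⁅x, bas K 𝔤 j⁆ F)) *
      (genX κ (dualBas κ i) * genY κ (dualBas κ j)) := by
    intro i
    exact casimir_invariant κ ((LinearMap.mul K (AlgBB κ)).compl₁₂
      ((evalZ κ).toLinearMap ∘ₗ dirDeriv κ (bas K 𝔤 i) ∘ₗ (dirDerivₗ κ).flip F)
      (LinearMap.mulLeft K (genX κ (dualBas κ i)) ∘ₗ genY κ)) x
  -- `e1` and `e2` cancel the terms in which `x` acts on `∂_i` and on `∂_j`.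
  simp_rw [map_sum, actBB_evalZ_mul, actBB_genX_mul, hY,
    actS_dirDeriv_dirDeriv_of_mem_invS κ hF, map_add, add_mul, mul_add, Finset.sum_add_distrib, e2]
  conv_lhs => enter [2, 1]; rw [Finset.sum_comm]
  simp_rw [e1, Finset.sum_neg_distrib]
  conv_lhs => enter [2, 1, 1]; rw [Finset.sum_comm]
  abel

end Action

/-! ### Vanishing -/

section Vanishing

variable {K : Type*} [Field K] {𝔤 : Type*} [LieRing 𝔤] [LieAlgebra K 𝔤] [FiniteDimensional K 𝔤]

theorem superBracket_genX (κ : InvForm K 𝔤) (a : 𝔤) :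
    superBracket κ (genX κ) (genX κ) a = 0 := by
  rw [genX, ← map_superBracket, superBracket_genB, map_zero]

theorem superBracket_genY (κ : InvForm K 𝔤) (a : 𝔤) :
    superBracket κ (genY κ) (genY κ) a = 0 := by
  rw [genY, ← map_superBracket, superBracket_genB, map_zero]

theorem evalZ_ι (κ : InvForm K 𝔤) (a : 𝔤) :
    evalZ κ (SymmetricAlgebra.ι K 𝔤 a) = superBracket κ (genX κ) (genY κ) a :=
  symLift_ι _ _ a

theorem genX_genY (κ : InvForm K 𝔤) (a c : 𝔤) :
    genX κ a * genY κ c = -(genY κ c * genX κ a) := by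
  rw [genY_genX, neg_neg]

/-- The Leibniz rule for second derivatives, contracted with `X ⊗ Y`. The two mixed terms are
`dF(Z)(X) dH(Z)(Y)` and `dH(Z)(X) dF(Z)(Y)`. -/
theorem hat_mul (κ : InvForm K 𝔤) (F H : SymmetricAlgebra K 𝔤) :
    hat κ (F * H) = evalZ κ F * hat κ H + evalZ κ H * hat κ F +
      ∑ j, evalZ κ (dirDeriv κ (bas K 𝔤 j) H) * dEvalZ κ (genX κ) F * genY κ (dualBas κ j) +
      ∑ j, evalZ κ (dirDeriv κ (bas K 𝔤 j) F) * dEvalZ κ (genX κ) H * genY κ (dualBas κ j) := by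
  have h : ∀ F H : SymmetricAlgebra K 𝔤,
      ∑ j, evalZ κ (dirDeriv κ (bas K 𝔤 j) H) * dEvalZ κ (genX κ) F * genY κ (dualBas κ j)
      = ∑ i, ∑ j, evalZ κ (dirDeriv κ (bas K 𝔤 j) H * dirDeriv κ (bas K 𝔤 i) F) *
        (genX κ (dualBas κ i) * genY κ (dualBas κ j)) := by
    intro F H
    rw [Finset.sum_comm]
    simp_rw [dEvalZ, Finset.mul_sum, Finset.sum_mul, map_mul, mul_assoc]
  simp_rw [h, hat, Finset.mul_sum, ← Finset.sum_add_distrib]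
  refine Finset.sum_congr rfl fun i _ => Finset.sum_congr rfl fun j _ => ?_
  simp only [dirDeriv_mul, map_add, map_mul, add_mul, mul_assoc]
  abel

variable [CharZero K] (κ : InvForm K 𝔤) {k : ℕ} {F : SymmetricAlgebra K 𝔤}

theorem evalZ_eq_zero (hk : k ≠ 0) (hF : F ∈ invS K 𝔤) (hFk : F ∈ homogS K 𝔤 k) :
    evalZ κ F = 0 :=
  eval_superBracket_eq_zero (evalZ_ι κ) (genX_anti κ) (genY_genX κ) (superBracket_genX κ) hk hF hFk

theorem dEvalZ_genX_eq_zero (hZ : LieAlgebra.center K 𝔤 = ⊥) (hF : F ∈ invS K 𝔤)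
    (hFk : F ∈ homogS K 𝔤 k) : dEvalZ κ (genX κ) F = 0 := by
  by_cases hk : k = 1
  · subst hk
    simp [eq_zero_of_mem_invS_of_mem_homogS_one hZ hF hFk, dEvalZ]
  · exact sum_eval_dirDeriv_mul_eq_zero (evalZ_ι κ) (genX_anti κ) (genY_genX κ)
      (superBracket_genX κ) hk hF hFk

theorem dEvalZ_genY_eq_zero (hZ : LieAlgebra.center K 𝔤 = ⊥) (hF : F ∈ invS K 𝔤)
    (hFk : F ∈ homogS K 𝔤 k) : dEvalZ κ (genY κ) F = 0 := by
  by_cases hk : k = 1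
  · subst hk
    simp [eq_zero_of_mem_invS_of_mem_homogS_one hZ hF hFk, dEvalZ]
  · refine sum_eval_dirDeriv_mul_eq_zero (g := genX κ) (fun a => ?_) (genY_anti κ) (genX_genY κ)
      (superBracket_genY κ) hk hF hFk
    rw [evalZ_ι, superBracket_symm κ _ _ (genY_genX κ)]

end Vanishing

end SuperLie

end

theorem mainTheorem3 {𝔤 : Type*} [LieRing 𝔤] [LieAlgebra ℂ 𝔤] [FiniteDimensional ℂ 𝔤]
    [LieAlgebra.IsSimple ℂ 𝔤] (κ : SuperLie.InvForm ℂ 𝔤) :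
    (∀ F ∈ SuperLie.invS ℂ 𝔤, SuperLie.hat κ F ∈ SuperLie.invE κ) ∧
    (∀ k : ℕ, 0 < k → ∀ F ∈ SuperLie.invS ℂ 𝔤, F ∈ SuperLie.homogS ℂ 𝔤 k →
      SuperLie.evalZ κ F = 0 ∧
      SuperLie.dEvalZ κ (SuperLie.genX κ) F = 0 ∧
      SuperLie.dEvalZ κ (SuperLie.genY κ) F = 0) ∧
    (∀ k l : ℕ, 0 < k → 0 < l → ∀ F ∈ SuperLie.invS ℂ 𝔤, ∀ H ∈ SuperLie.invS ℂ 𝔤,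
      F ∈ SuperLie.homogS ℂ 𝔤 k → H ∈ SuperLie.homogS ℂ 𝔤 l →
      SuperLie.hat κ (F * H) = 0) := by
  have hZ : LieAlgebra.center ℂ 𝔤 = ⊥ := LieAlgebra.center_eq_bot ℂ 𝔤
  refine ⟨fun F hF => SuperLie.hat_mem_invE κ hF, fun k hk F hF hFk => ?_,
    fun k l hk hl F hF H hH hFk hHl => ?_⟩
  · exact ⟨SuperLie.evalZ_eq_zero κ hk.ne' hF hFk, SuperLie.dEvalZ_genX_eq_zero κ hZ hF hFk,
      SuperLie.dEvalZ_genY_eq_zero κ hZ hF hFk⟩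
  · rw [SuperLie.hat_mul, SuperLie.evalZ_eq_zero κ hk.ne' hF hFk,
      SuperLie.evalZ_eq_zero κ hl.ne' hH hHl, SuperLie.dEvalZ_genX_eq_zero κ hZ hF hFk,
      SuperLie.dEvalZ_genX_eq_zero κ hZ hH hHl]
    simp
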